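/- For an integer $n\ge 1$ let $\mathfrak B_n$ be the moduli space of based rank-$n$ algebras: the affine scheme of finite type over $\mathbb Z$ parameterizing commutative, associative, unital algebras equipped with an isomorphism of modules to the free module of rank $n$. Explicitly, $\mathfrak B_n$ is the closed subscheme of $\mathbb A^{n^3+n}_{\mathbb Z}$, with coordinates $c_{ij}^{\ell}$ and $d_i$ ($1\le i,j,\ell\le n$), cut out by the polynomial conditions that say that the multiplication law $e_ie_j=\sum_{\ell} c_{ij}^{\ell}e_\ell$ is commutative and associative and has $\sum_i d_ie_i$ as a multiplicative identity. For a field $k$ let $\mathfrak B_{n,k}=\mathfrak B_n\times_{\operatorname{Spec}\mathbb Z}\operatorname{Spec} k$. Theorem. For every integer $n\ge 1$ and every field $k$, the (finite) dimension of $\mathfrak B_{n,k}$ satisfies $$\dim \mathfrak B_{n,k}\ \ge\ \begin{cases}\frac{2}{27}n^3+\frac19 n^2+\frac53 n-1 & \text{if } n\equiv 0 \pmod 3,\\[2pt] \frac{2}{27}n^3+\frac19 n^2+\frac{14}{9}n-\frac{20}{27} & \text{if } n\equiv 1\pmod 3,\\[2pt] \frac{2}{27}n^3+\frac19 n^2+\frac53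 n-\frac{37}{27} & \text{if } n\equiv 2\pmod 3.\end{cases}$$ In particular, $\dim\mathfrak B_{n,k}>n^2$ for all $n\ge 11$. -/

import Mathlib

open CategoryTheory CategoryTheory.Limits AlgebraicGeometry

universe u

namespace BasedAlgebras

/-- The indeterminates: `c i j l` (there are `n ^ 3` of them) and `d i` (there are `n`). -/
inductive Var (n : ℕ) : Type
  | c (i j l : Fin n) : Var n
  | d (i : Fin n) : Var n

/-- The integers, in an arbitrary universe. -/
abbrev IntU : Type u := ULift.{u} ℤ

/-- The polynomial ring over the integers in the `n ^ 3 + n` indeterminates. -/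
abbrev Poly (n : ℕ) : Type u := MvPolynomial (Var n) IntU.{u}

/-- The generic structure constant `c i j l`. -/
noncomputable def genC (n : ℕ) (i j l : Fin n) : Poly.{u} n := MvPolynomial.X (Var.c i j l)

/-- The generic coordinate `d i` of the unit. -/
noncomputable def genD (n : ℕ) (i : Fin n) : Poly.{u} n := MvPolynomial.X (Var.d i)

/-- The ideal generated by the polynomial conditions that say that the multiplication law with
structure constants `c i j l` is commutative and associative and has `∑ i, d i • e i` as a
multiplicative identity. -/
noncomputable def relations (n : ℕ) : Ideal (Poly.{u} n) :=
  Ideal.span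
    ({p | ∃ i j l, p = genC n i j l - genC n j i l} ∪
      {p | ∃ i j m l, p = ∑ t, genC n i j t * genC n t m l - ∑ t, genC n j m t * genC n i t l} ∪
      {p | ∃ j l, p = ∑ i, genD n i * genC n i j l - if j = l then 1 else 0})

/-- The coordinate ring of the moduli space of based rank-`n` algebras. -/
abbrev CoordRing (n : ℕ) : Type u := Poly.{u} n ⧸ relations.{u} n

/-- The moduli space of based rank-`n` algebras: the closed subscheme of affine
`(n ^ 3 + n)`-space over the integers cut out by the above conditions. -/
noncomputable def moduliSpace (n : ℕ) : Scheme.{u} := Spec (CommRingCat.of (CoordRing.{u} n))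

/-- The base change of a scheme `V` to a field `k`: the fibre product of `V` and `Spec k` over
`Spec ℤ`. -/
noncomputable def baseChange (V : Scheme.{u}) (k : Type u) [Field k] : Scheme.{u} :=
  pullback (specULiftZIsTerminal.from V)
    (specULiftZIsTerminal.from (Spec (CommRingCat.of k)))

/-! The remaining declarations check that `moduliSpace n` represents the intended functor on
affine schemes: its points over a commutative ring `R` are the based rank-`n` algebras over `R`. -/

/-- A based rank-`n` algebra over `R`, up to isomorphism of based algebras: a commutative,
associative, unital multiplication on the `R`-module `R^n`. -/
structure BasedAlgebra (n : ℕ) (R : Type*) [CommRing R] where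
  mul : (Fin n → R) →ₗ[R] (Fin n → R) →ₗ[R] (Fin n → R)
  one : Fin n → R
  mul_comm : ∀ x y, mul x y = mul y x
  mul_assoc : ∀ x y z, mul (mul x y) z = mul x (mul y z)
  one_mul : ∀ x, mul one x = x

/-- Structure constants of a based commutative, associative, unital algebra of rank `n` over `R`:
`e i * e j = ∑ l, c i j l • e l` and `1 = ∑ i, d i • e i`, where `e` is the standard basis
of `R^n`. -/
structure IsStructureConstants {R : Type*} [CommRing R] {n : ℕ}
    (c : Fin n → Fin n → Fin n → R) (d : Fin n → R) : Prop where
  comm : ∀ i j l, c i j l = c j i l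
  assoc : ∀ i j m l, ∑ t, c i j t * c t m l = ∑ t, c j m t * c i t l
  one_mul : ∀ j l, ∑ i, d i * c i j l = if j = l then 1 else 0

/-- The multiplication law on `R^n` with structure constants `c`. -/
noncomputable def mulOf {R : Type*} [CommRing R] {n : ℕ} (c : Fin n → Fin n → Fin n → R) :
    (Fin n → R) →ₗ[R] (Fin n → R) →ₗ[R] (Fin n → R) :=
  (Pi.basisFun R (Fin n)).constr R fun i => (Pi.basisFun R (Fin n)).constr R fun j => c i j

theorem mulOf_single {R : Type*} [CommRing R] {n : ℕ} (c : Fin n → Fin n → Fin n → R)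
    (i j : Fin n) : mulOf c (Pi.single i 1) (Pi.single j 1) = c i j := by
  have h := fun i : Fin n => Pi.basisFun_apply R (Fin n) i
  rw [mulOf, ← h i, ← h j, Module.Basis.constr_basis, Module.Basis.constr_basis]

theorem sum_single {R : Type*} [CommRing R] {n : ℕ} (x : Fin n → R) :
    x = ∑ t, x t • (Pi.single t 1 : Fin n → R) := by
  conv_lhs => rw [← (Pi.basisFun R (Fin n)).sum_repr x]
  simp

/-- The conditions on structure constants say exactly that the multiplication law is
commutative and associative with unit `d`. -/
theorem isStructureConstants_iff {R : Type*} [CommRing R] {n : ℕ}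
    (m : (Fin n → R) →ₗ[R] (Fin n → R) →ₗ[R] (Fin n → R)) (d : Fin n → R) :
    IsStructureConstants (fun i j => m (Pi.single i 1) (Pi.single j 1)) d ↔
      (∀ x y, m x y = m y x) ∧ (∀ x y z, m (m x y) z = m x (m y z)) ∧ (∀ x, m d x = x) := by
  have key1 : ∀ (x : Fin n → R) (z : Fin n → R) (l : Fin n),
      m x z l = ∑ t, x t * m (Pi.single t 1) z l := by
    intro x z l
    conv_lhs => rw [sum_single x]
    simp [map_sum, LinearMap.sum_apply, Finset.sum_apply]
  have key2 : ∀ (z : Fin n → R) (x : Fin n → R) (l : Fin n),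
      m z x l = ∑ t, x t * m z (Pi.single t 1) l := by
    intro z x l
    conv_lhs => rw [sum_single x]
    simp [map_sum, Finset.sum_apply]
  constructor
  · intro h
    refine ⟨?_, ?_, ?_⟩
    · have e : m = m.flip := by
        refine (Pi.basisFun R (Fin n)).ext fun i => (Pi.basisFun R (Fin n)).ext fun j => ?_
        funext l
        simpa using h.comm i j l
      intro x y
      exact congrArg (fun f => f x y) e
    · have e : (LinearMap.compr₂ m m) =
          (LinearMap.llcomp R (Fin n → R) (Fin n → R) (Fin n → R) ∘ₗ m).compl₂ m := by
        refine (Pi.basisFun R (Fin n)).ext fun i => (Pi.basisFun R (Fin n)).ext fun j =>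
          (Pi.basisFun R (Fin n)).ext fun k => ?_
        funext l
        simp only [Pi.basisFun_apply, LinearMap.compr₂_apply, LinearMap.comp_apply,
          LinearMap.compl₂_apply, LinearMap.llcomp_apply]
        rw [key1, key2]
        exact h.assoc i j k l
      intro x y z
      exact congrArg (fun f => f x y z) e
    · have e : m d = LinearMap.id := by
        refine (Pi.basisFun R (Fin n)).ext fun j => ?_
        funext l
        simp only [Pi.basisFun_apply, LinearMap.id_apply]
        rw [key1, h.one_mul j l]
        simp [Pi.single_apply, eq_comm]
      intro x
      exact congrArg (fun f => f x) e
  · rintro ⟨h1, h2, h3⟩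
    refine ⟨fun i j l => congrFun (h1 _ _) l, fun i j k l => ?_, fun j l => ?_⟩
    · rw [← key1, ← key2, h2]
    · rw [← key1, h3]
      simp [Pi.single_apply, eq_comm]

/-- Homomorphisms from the coordinate ring to `R` are the systems of structure constants
in `R`. -/
noncomputable def homEquiv (n : ℕ) (R : Type*) [CommRing R] :
    (CoordRing.{u} n →+* R) ≃
      {p : (Fin n → Fin n → Fin n → R) × (Fin n → R) // IsStructureConstants p.1 p.2} where
  toFun f := ⟨(fun i j l => f (Ideal.Quotient.mk _ (genC n i j l)),
      fun i => f (Ideal.Quotient.mk _ (genD n i))), by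
    have hz : ∀ p ∈ relations.{u} n, f (Ideal.Quotient.mk _ p) = 0 := fun p hp => by
      rw [Ideal.Quotient.eq_zero_iff_mem.2 hp, map_zero]
    refine ⟨fun i j l => ?_, fun i j m l => ?_, fun j l => ?_⟩
    · have := hz _ (Ideal.subset_span (Or.inl (Or.inl ⟨i, j, l, rfl⟩)))
      simpa [sub_eq_zero] using this
    · have := hz _ (Ideal.subset_span (Or.inl (Or.inr ⟨i, j, m, l, rfl⟩)))
      simpa [sub_eq_zero] using this
    · have := hz _ (Ideal.subset_span (Or.inr ⟨j, l, rfl⟩))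
      split_ifs with h <;> simpa [sub_eq_zero, h] using this⟩
  invFun p := Ideal.Quotient.lift _
    (MvPolynomial.eval₂Hom ((Int.castRingHom R).comp ULift.ringEquiv.toRingHom)
      (fun v => match v with
        | Var.c i j l => p.1.1 i j l
        | Var.d i => p.1.2 i)) (by
      intro a ha
      rw [← RingHom.mem_ker]
      revert a
      change relations.{u} n ≤ _
      refine Ideal.span_le.2 ?_
      rintro _ ((⟨i, j, l, rfl⟩ | ⟨i, j, m, l, rfl⟩) | ⟨j, l, rfl⟩)
      · simpa [genC, sub_eq_zero] using p.2.comm i j l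
      · simpa [genC, sub_eq_zero] using p.2.assoc i j m l
      · have := p.2.one_mul j l
        split_ifs at this ⊢ with h <;> simpa [genC, genD, sub_eq_zero] using this)
  left_inv f := by
    refine Ideal.Quotient.ringHom_ext (MvPolynomial.ringHom_ext (fun z => ?_) (fun v => ?_))
    · obtain ⟨z⟩ := z
      have e : (ULift.up z : IntU.{u}) = (z : IntU.{u}) := rfl
      rw [e]
      simp
    · cases v <;> simp [genC, genD]
  right_inv p := by
    refine Subtype.ext (Prod.ext ?_ ?_)
    · funext i j l
      simp [genC]
    · funext i
      simp [genD]

/-- The functor of points on affine schemes: homomorphisms from the coordinate ring to `R` are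
the based rank-`n` algebras over `R`. -/
noncomputable def pointsEquiv (n : ℕ) (R : Type*) [CommRing R] :
    (CoordRing.{u} n →+* R) ≃ BasedAlgebra n R :=
  (homEquiv n R).trans
    { toFun := fun p =>
        have h := (isStructureConstants_iff (mulOf p.1.1) p.1.2).1 (by
          simpa only [mulOf_single] using p.2)
        ⟨mulOf p.1.1, p.1.2, h.1, h.2.1, h.2.2⟩
      invFun := fun A => ⟨(fun i j => A.mul (Pi.single i 1) (Pi.single j 1), A.one),
        (isStructureConstants_iff A.mul A.one).2 ⟨A.mul_comm, A.mul_assoc, A.one_mul⟩⟩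
      left_inv := fun p => by
        refine Subtype.ext (Prod.ext ?_ rfl)
        funext i j
        exact mulOf_single _ i j
      right_inv := fun A => by
        have e : mulOf (fun i j => A.mul (Pi.single i 1) (Pi.single j 1)) = A.mul := by
          refine (Pi.basisFun R (Fin n)).ext fun i => (Pi.basisFun R (Fin n)).ext fun j => ?_
          simp only [Pi.basisFun_apply]
          exact mulOf_single _ i j
        cases A
        simp only at e
        simp only [e] }

end BasedAlgebras

/-! The bound comes from one family of local algebras: `K ⊕ V ⊕ W` with `dim V = d`, `dim W = r`, `n
= d + r + 1`, `V * V ⊆ W` and every product of three elements of `V ⊕ W` zero. Any symmetric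
bilinear map `V × V → W` is associative for this trivial reason. Such a based algebra is given by
its unit `u` (`n` parameters), the augmentation `ε` (`n - 1` more, as `ε u = 1`), the position of
`W` in the maximal ideal (`p`, `d * r` parameters) and the multiplication (`q`, `r * (d + 1).choose
2` parameters). The leading term `d ^ 2 * r / 2` is largest for `d` near `2 * n / 3`, which gives `2
/ 27 * n ^ 3`.

To see that the family really has this dimension, take the parameters to be independent variables
and let `K` be their field of fractions. The generic member is a `K`-point of the moduli space. The
parameters are recovered from its structure constants (`augVec_mem`, `quadric_mem`, `projVec_mem`),
so `K` is algebraic over the image of the coordinate ring of the fibre, whose dimension is then at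
least the number of parameters (`natCard_le_ringKrullDim_of_isAlgebraic_range`). -/

/-! ### Krull dimension and transcendence degree -/

theorem ringKrullDim_le_of_isIntegral_of_injective {R S : Type*} [CommRing R] [CommRing S]
    [Algebra R S] [Algebra.IsIntegral R S] (h : Function.Injective (algebraMap R S)) :
    ringKrullDim R ≤ ringKrullDim S := by
  have hs : Function.Surjective (PrimeSpectrum.comap (algebraMap R S)) := by
    intro p
    obtain ⟨Q, -, hQ, hc⟩ := Ideal.exists_ideal_over_prime_of_isIntegral p.asIdeal (⊥ : Ideal S)
      (by
        change RingHom.ker (algebraMap R S) ≤ _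
        rw [(RingHom.injective_iff_ker_eq_bot _).1 h]
        exact bot_le)
    exact ⟨⟨Q, hQ⟩, PrimeSpectrum.ext hc⟩
  refine iSup_le fun l => ?_
  -- Lying over lifts the bottom prime of the chain; going up lifts the rest without changing the
  -- length.
  obtain ⟨P, hP⟩ := hs l.head
  have : P.asIdeal.LiesOver l.head.asIdeal := ⟨by rw [← hP]; rfl⟩
  obtain ⟨L, hL, -⟩ := Ideal.exists_ltSeries_of_hasGoingUp (S := S) l P.asIdeal
  rw [← hL]
  exact Order.LTSeries.length_le_krullDim L

/-- If `A` is a finitely generated algebra over a field `k` and `K` is algebraic over the image of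
`A`, then the Krull dimension of `A` is at least the transcendence degree of `K`. -/
theorem natCard_le_ringKrullDim_of_isAlgebraic_range {k A K ι : Type*} [Field k] [CommRing A]
    [Algebra k A] [Algebra.FiniteType k A] [Field K] [Algebra k K] [Finite ι]
    (f : A →ₐ[k] K) [Algebra.IsAlgebraic f.range K] {x : ι → K}
    (hx : AlgebraicIndependent k x) :
    (Nat.card ι : WithBot ℕ∞) ≤ ringKrullDim A := by
  have : Algebra.FiniteType k f.range :=
    Algebra.FiniteType.of_surjective f.rangeRestrict f.rangeRestrict_surjective
  refine le_trans ?_ (ringKrullDim_le_of_surjective f.rangeRestrict.toRingHom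
    f.rangeRestrict_surjective)
  -- Noether normalization: the image is integral over a polynomial ring in `s` variables, so its
  -- dimension is at least `s`. Since `K` is algebraic over the `s` images `y` of the variables, its
  -- transcendence degree is at most `s`.
  obtain ⟨s, g, hg, hint⟩ := exists_integral_inj_algHom_of_fg k f.range
  have hdim : (s : WithBot ℕ∞) ≤ ringKrullDim f.range := by
    let := g.toRingHom.toAlgebra
    have : Algebra.IsIntegral (MvPolynomial (Fin s) k) f.range := ⟨hint⟩
    have := ringKrullDim_le_of_isIntegral_of_injective (R := MvPolynomial (Fin s) k)
      (S := f.range) hg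
    simpa using this
  refine le_trans ?_ hdim
  let y : Fin s → K := fun i => f.range.val (g (MvPolynomial.X i))
  have hy : f.range.val.comp g = MvPolynomial.aeval y := MvPolynomial.algHom_ext fun i => by
    simp [y]
  have halg : Algebra.IsAlgebraic (Algebra.adjoin k (Set.range y)) K := by
    let B' := Algebra.adjoin k (Set.range y)
    have hmem : ∀ a, f.range.val (g a) ∈ B' := fun a => by
      have : f.range.val (g a) = MvPolynomial.aeval y a := DFunLike.congr_fun hy a
      rw [this]
      change _ ∈ Algebra.adjoin k (Set.range y)
      rw [Algebra.adjoin_range_eq_range_aeval]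
      exact ⟨a, rfl⟩
    have hb : ∀ b : f.range, IsIntegral B' (b : K) := fun b => by
      obtain ⟨P, hP, hPb⟩ := hint b
      let φ : MvPolynomial (Fin s) k →+* B' :=
        ((f.range.val.comp g).codRestrict B' hmem).toRingHom
      refine ⟨P.map φ, hP.map _, ?_⟩
      rw [Polynomial.eval₂_map]
      have := congrArg f.range.val hPb
      rw [map_zero] at this
      rw [← this]
      exact (Polynomial.hom_eval₂ P g.toRingHom f.range.val.toRingHom b).symm
    -- `C` contains the image of `f`, so `K` is algebraic over `C`, and `C` is integral over `B'`.
    let C := integralClosure B' K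
    let ψ : f.range →+* C :=
      { toFun b := ⟨b, hb b⟩
        map_one' := rfl
        map_mul' _ _ := rfl
        map_zero' := rfl
        map_add' _ _ := rfl }
    have hC : Algebra.IsAlgebraic C K := ⟨fun z => by
      obtain ⟨P, hP, hz⟩ := Algebra.IsAlgebraic.isAlgebraic (R := f.range) z
      refine ⟨P.map ψ, ?_, ?_⟩
      · rwa [Ne, Polynomial.map_eq_zero_iff]
        intro a b hab
        exact Subtype.ext (congrArg (fun c : C => (c : K)) hab)
      · rw [Polynomial.aeval_def, Polynomial.eval₂_map]
        exact hz⟩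
    exact Algebra.IsAlgebraic.trans B' C K
  have h1 := Algebra.IsAlgebraic.trdeg_le_cardinalMk k (Set.range y)
  have h2 := hx.lift_cardinalMk_le_trdeg
  have h3 : (Nat.card ι : Cardinal.{0}) ≤ s := by
    have h4 : Cardinal.mk (Set.range y) ≤ s := by
      have := Cardinal.mk_range_le_lift (f := y)
      simpa using this
    have h5 := h2.trans (Cardinal.lift_le.2 (h1.trans h4))
    rw [← Nat.cast_card, Cardinal.lift_natCast, Cardinal.lift_natCast] at h5
    exact_mod_cast h5
  exact_mod_cast h3

theorem exists_natCast_eq_ringKrullDim (k A : Type*) [Field k] [CommRing A] [Nontrivial A]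
    [Algebra k A] [Algebra.FiniteType k A] : ∃ D : ℕ, ringKrullDim A = D := by
  obtain ⟨m, f, hf⟩ := Algebra.FiniteType.iff_quotient_mvPolynomial''.1
    (inferInstance : Algebra.FiniteType k A)
  have h1 := ringKrullDim_le_of_surjective f.toRingHom hf
  have h0 := ringKrullDim_nonneg_of_nontrivial (R := A)
  rw [MvPolynomial.ringKrullDim_of_isNoetherianRing, ringKrullDim_eq_zero_of_field, zero_add,
    Nat.card_fin] at h1
  generalize ringKrullDim A = x at h0 h1
  induction x with
  | bot => simp at h0
  | coe x =>
    induction x with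
    | top => exact absurd (WithBot.coe_le_coe.1 h1) (by simp)
    | coe x => exact ⟨x, rfl⟩

namespace BasedAlgebras

/-! ### Algebras in which triple products in the augmentation ideal vanish -/

section SquareZero

variable {K E F : Type*} [CommRing K] [AddCommGroup E] [Module K E] [AddCommGroup F] [Module K F]

/-- The multiplication on `E` with unit `u` and augmentation `ε` that is given by `Q ∘ (π × π)`
on the kernel of `ε`. -/
noncomputable def augMul (ε : E →ₗ[K] K) (u : E) (π : E →ₗ[K] F) (Q : F →ₗ[K] F →ₗ[K] E) :
    E →ₗ[K] E →ₗ[K] E :=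
  LinearMap.mk₂ K (fun x y => ε y • x + ε x • y - (ε x * ε y) • u + Q (π x) (π y))
    (fun x x' y => by simp only [map_add, LinearMap.add_apply]; module)
    (fun a x y => by simp only [map_smul, LinearMap.smul_apply, smul_eq_mul]; module)
    (fun x y y' => by simp only [map_add]; module)
    (fun a x y => by simp only [map_smul, smul_eq_mul]; module)

variable {ε : E →ₗ[K] K} {u : E} {π : E →ₗ[K] F} {Q : F →ₗ[K] F →ₗ[K] E}

theorem augMul_apply (x y : E) :
    augMul ε u π Q x y = ε y • x + ε x • y - (ε x * ε y) • u + Q (π x) (π y) := rfl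

theorem augMul_comm (hQ : ∀ a b, Q a b = Q b a) (x y : E) :
    augMul ε u π Q x y = augMul ε u π Q y x := by
  rw [augMul_apply, augMul_apply, hQ (π x)]
  module

theorem augMul_one (hε : ε u = 1) (hπ : π u = 0) (x : E) : augMul ε u π Q u x = x := by
  rw [augMul_apply, hε, hπ, map_zero, LinearMap.zero_apply]
  module

theorem aug_augMul (hε : ε u = 1) (hεQ : ∀ a b, ε (Q a b) = 0) (x y : E) :
    ε (augMul ε u π Q x y) = ε x * ε y := by
  simp only [augMul_apply, map_add, map_sub, map_smul, hε, hεQ, smul_eq_mul]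
  ring

theorem proj_augMul (hπ : π u = 0) (hπQ : ∀ a b, π (Q a b) = 0) (x y : E) :
    π (augMul ε u π Q x y) = ε y • π x + ε x • π y := by
  simp only [augMul_apply, map_add, map_sub, map_smul, hπ, hπQ]
  module

/-- `ε` is multiplicative and `π` is a derivation along `ε`. As both kill the values of `Q`, no
iterated `Q` survives, and both sides expand to the same expression, symmetric in the roles of the
factors. -/
theorem augMul_assoc (hε : ε u = 1) (hπ : π u = 0)
    (hεQ : ∀ a b, ε (Q a b) = 0) (hπQ : ∀ a b, π (Q a b) = 0) (x y z : E) :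
    augMul ε u π Q (augMul ε u π Q x y) z = augMul ε u π Q x (augMul ε u π Q y z) := by
  rw [augMul_apply _ z, augMul_apply x (augMul _ _ _ _ _ _), aug_augMul hε hεQ,
    aug_augMul hε hεQ, proj_augMul hπ hπQ, proj_augMul hπ hπQ]
  simp only [augMul_apply, map_add, map_smul, LinearMap.add_apply, LinearMap.smul_apply]
  module

end SquareZero

/-! ### The family with parameters `u`, `ε`, `p`, `q` -/

section Family

variable {K V W : Type*} [Field K] [Fintype V] [Fintype W]
  {n : ℕ} (e : Fin n ≃ Option (V ⊕ W))
  (u : Option (V ⊕ W) → K) (ε : V ⊕ W → K) (p : V → W → K) (q : Sym2 V → W → K)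

/-- The values on the basis of the linear form that is `1` on `u` and `ε i` on the `i`-th basis
vector. -/
noncomputable def augVec : Option (V ⊕ W) → K
  | none => (1 - ∑ i, ε i * u (some i)) / u none
  | some i => ε i

/-- The linear form with prescribed values on the basis. -/
noncomputable def form (a : Option (V ⊕ W) → K) : (Fin n → K) →ₗ[K] K :=
  ∑ i, a i • LinearMap.proj (e.symm i)

theorem form_apply (a : Option (V ⊕ W) → K) (x : Fin n → K) :
    form e a x = ∑ i, a i * x (e.symm i) := by
  simp [form]

theorem form_comp (a b : Option (V ⊕ W) → K) : form e a (b ∘ e) = ∑ i, a i * b i := by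
  simp [form_apply]

theorem form_single (a : Option (V ⊕ W) → K) (i : Option (V ⊕ W)) :
    form e a (Pi.single (e.symm i) 1) = a i := by
  classical
  simp [form_apply, Pi.single_apply]

variable {u} in
theorem form_augVec_unit (hu : u none ≠ 0) : form e (augVec u ε) (u ∘ e) = 1 := by
  rw [form_comp, Fintype.sum_option]
  simp only [augVec]
  field_simp
  ring

variable [DecidableEq V] [DecidableEq W]

/-- The values on the basis of the linear form that vanishes on `u`, is the `v`-th coordinate
on `V`, and is `p v` on `W`. -/
noncomputable def projVec (v : V) : Option (V ⊕ W) → K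
  | none => -(u (some (.inl v)) + ∑ w, p v w * u (some (.inr w))) / u none
  | some (.inl v') => if v' = v then 1 else 0
  | some (.inr w) => p v w

/-- The basis of the common kernel of the forms `augVec` and `projVec` that is the standard basis
modulo `V` and `u`. -/
noncomputable def kerVec (w : W) : Option (V ⊕ W) → K
  | none => -((ε (.inr w) - ∑ v, p v w * ε (.inl v)) * u none)
  | some (.inl v) => - p v w - (ε (.inr w) - ∑ v, p v w * ε (.inl v)) * u (some (.inl v))
  | some (.inr w') =>
    (if w = w' then 1 else 0) - (ε (.inr w) - ∑ v, p v w * ε (.inl v)) * u (some (.inr w'))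

/-- The projection with coordinates `projVec`. -/
noncomputable def projMap : (Fin n → K) →ₗ[K] (V → K) :=
  LinearMap.pi fun v => form e (projVec u p v)

/-- The bilinear map with values in the span of the `kerVec`. -/
noncomputable def bilinMap : (V → K) →ₗ[K] (V → K) →ₗ[K] (Fin n → K) :=
  ∑ w, (Matrix.toBilin' (Matrix.of fun v v' => q s(v, v') w)).compr₂
    (LinearMap.toSpanSingleton K _ (kerVec u ε p w ∘ e))

theorem bilinMap_apply (x y : V → K) :
    bilinMap e u ε p q x y =
      ∑ w, Matrix.toBilin' (Matrix.of fun v v' => q s(v, v') w) x y • (kerVec u ε p w ∘ e) := by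
  simp [bilinMap, LinearMap.sum_apply]

theorem bilinMap_comm (x y : V → K) :
    bilinMap e u ε p q x y = bilinMap e u ε p q y x := by
  simp only [bilinMap_apply]
  refine Finset.sum_congr rfl fun w _ => ?_
  congr 1
  simp only [Matrix.toBilin'_apply, Matrix.of_apply]
  rw [Finset.sum_comm]
  refine Finset.sum_congr rfl fun v _ => Finset.sum_congr rfl fun v' _ => ?_
  rw [Sym2.eq_swap]
  ring

theorem bilinMap_single (v v' : V) :
    bilinMap e u ε p q (Pi.single v 1) (Pi.single v' 1) =
      ∑ w, q s(v, v') w • (kerVec u ε p w ∘ e) := by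
  simp [bilinMap_apply, Matrix.toBilin'_single]

variable {u}

omit [DecidableEq W] in
theorem projMap_unit (hu : u none ≠ 0) : projMap e u p (u ∘ e) = 0 := by
  funext v
  simp only [projMap, LinearMap.pi_apply, form_comp, Fintype.sum_option, Fintype.sum_sum_type,
    projVec, ite_mul, one_mul, zero_mul, Finset.sum_ite_eq', Finset.mem_univ, if_true,
    Pi.zero_apply]
  field_simp
  ring

-- `kerVec w` is `e_w - ∑ v, p v w • e_v - α • u`. The first two terms are already killed by the
-- projection, and `α` is their augmentation, so subtracting `α • u` moves the vector into the
-- kernel of the augmentation too.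
omit [DecidableEq V] in
theorem form_augVec_kerVec (hu : u none ≠ 0) (w : W) :
    form e (augVec u ε) (kerVec u ε p w ∘ e) = 0 := by
  have h := form_augVec_unit e ε hu
  rw [form_comp, Fintype.sum_option, Fintype.sum_sum_type] at h ⊢
  generalize hα : ε (.inr w) - ∑ v, p v w * ε (.inl v) = α
  simp only [augVec, kerVec, hα] at h ⊢
  simp only [mul_sub, Finset.sum_sub_distrib, mul_ite, mul_one, mul_zero, Finset.sum_ite_eq,
    Finset.mem_univ, if_true, mul_neg, Finset.sum_neg_distrib, mul_left_comm _ α,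
    ← Finset.mul_sum]
  have h2 : ∑ v, ε (.inl v) * p v w = ∑ v, p v w * ε (.inl v) :=
    Finset.sum_congr rfl fun _ _ => mul_comm _ _
  rw [h2]
  linear_combination hα - α * h

theorem projMap_kerVec (hu : u none ≠ 0) (w : W) : projMap e u p (kerVec u ε p w ∘ e) = 0 := by
  funext v
  have h := congrFun (projMap_unit e p hu) v
  simp only [projMap, LinearMap.pi_apply, form_comp, Fintype.sum_option, Fintype.sum_sum_type,
    projVec, ite_mul, one_mul, zero_mul, Finset.sum_ite_eq', Finset.mem_univ, if_true,
    Pi.zero_apply] at h ⊢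
  generalize hα : ε (.inr w) - ∑ v, p v w * ε (.inl v) = α
  simp only [kerVec, hα]
  simp only [mul_sub, Finset.sum_sub_distrib, mul_ite, mul_one, mul_zero, Finset.sum_ite_eq,
    Finset.mem_univ, if_true, mul_neg, mul_left_comm _ α, ← Finset.mul_sum]
  linear_combination - α * h

variable (u)

/-- The multiplication of the family of local algebras with parameters `u`, `ε`, `p`, `q`. -/
noncomputable def familyMul : (Fin n → K) →ₗ[K] (Fin n → K) →ₗ[K] (Fin n → K) :=
  augMul (form e (augVec u ε)) (u ∘ e) (projMap e u p) (bilinMap e u ε p q)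

variable {u}

theorem form_augVec_bilinMap (hu : u none ≠ 0) (x y : V → K) :
    form e (augVec u ε) (bilinMap e u ε p q x y) = 0 := by
  simp [bilinMap_apply, form_augVec_kerVec e ε p hu]

theorem projMap_bilinMap (hu : u none ≠ 0) (x y : V → K) :
    projMap e u p (bilinMap e u ε p q x y) = 0 := by
  simp [bilinMap_apply, projMap_kerVec e ε p hu]

theorem isStructureConstants_familyMul (hu : u none ≠ 0) :
    IsStructureConstants
      (fun i j => familyMul e u ε p q (Pi.single i 1) (Pi.single j 1)) (u ∘ e) :=
  (isStructureConstants_iff _ _).2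
    ⟨augMul_comm (bilinMap_comm e u ε p q),
      augMul_assoc (form_augVec_unit e ε hu) (projMap_unit e p hu)
        (form_augVec_bilinMap e ε p q hu) (projMap_bilinMap e ε p q hu),
      augMul_one (form_augVec_unit e ε hu) (projMap_unit e p hu)⟩

/-! ### Recovering the parameters from the structure constants -/

section Recovery

variable {R : Type*} [CommRing R] [Algebra R K] (S : Subalgebra R K)
  (hint : ∀ x, IsIntegral S x → x ∈ S) (hinv : ∀ x ∈ S, x⁻¹ ∈ S)
  (hc : ∀ i j l, familyMul e u ε p q (Pi.single i 1) (Pi.single j 1) l ∈ S)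
  (hd : ∀ i, u i ∈ S)

-- Since the augmentation is multiplicative, multiplication by `ε(e_i)` maps the `S`-span of all the
-- values `ε(e_j)` to itself. This span is finitely generated, and nonzero because `ε(u) = 1`, so
-- `ε(e_i)` is integral over `S`.
include hint hc in
theorem augVec_mem (hu : u none ≠ 0) (i : Option (V ⊕ W)) : augVec u ε i ∈ S := by
  refine hint _ (isIntegral_of_smul_mem_submodule (M := K)
    (Submodule.span S (Set.range (augVec u ε))) ?_ (Submodule.fg_span (Set.finite_range _)) _ ?_)
  · intro h
    rw [Submodule.span_eq_bot] at h
    have h1 := form_augVec_unit e ε hu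
    rw [form_comp, Finset.sum_eq_zero fun i _ => by rw [h _ ⟨i, rfl⟩, zero_mul]] at h1
    exact zero_ne_one h1
  · intro x hx
    induction hx using Submodule.span_induction with
    | mem x hx =>
      obtain ⟨j, rfl⟩ := hx
      have h := aug_augMul (π := projMap e u p) (form_augVec_unit e ε hu)
        (form_augVec_bilinMap e ε p q hu) (Pi.single (e.symm i) 1) (Pi.single (e.symm j) 1)
      rw [form_single, form_single, form_apply] at h
      rw [smul_eq_mul, ← h]
      refine Submodule.sum_mem _ fun l _ => ?_
      rw [mul_comm]
      exact Submodule.smul_mem _ (⟨_, hc (e.symm i) (e.symm j) (e.symm l)⟩ : S)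
        (Submodule.subset_span ⟨l, rfl⟩)
    | zero => simp
    | add x y _ _ hx hy => rw [smul_add]; exact Submodule.add_mem _ hx hy
    | smul a x _ hx => rw [smul_comm]; exact Submodule.smul_mem _ _ hx

-- The projection sends `e_v` to the standard basis vector, so in `e_v * e_v'` every term other than
-- `Q(e_v, e_v')` involves only `ε` and `u`, which lie in `S`.
include hint hc hd in
theorem sum_mul_kerVec_mem (hu : u none ≠ 0) (v v' : V) (i : Option (V ⊕ W)) :
    ∑ w, q s(v, v') w * kerVec u ε p w i ∈ S := by
  have hs : ∀ v : V, projMap e u p (Pi.single (e.symm (some (.inl v))) 1) = Pi.single v 1 := by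
    intro v
    funext v'
    rw [projMap, LinearMap.pi_apply, form_single]
    simp [projVec, Pi.single_apply, eq_comm]
  have hε := augVec_mem e ε p q S hint hc hu
  have hsingle : ∀ i j : Fin n, (Pi.single i 1 : Fin n → K) j ∈ S := by
    intro i j
    rw [Pi.single_apply]
    split_ifs
    exacts [S.one_mem, S.zero_mem]
  have h := hc (e.symm (some (.inl v))) (e.symm (some (.inl v'))) (e.symm i)
  rw [familyMul, augMul_apply, hs, hs, bilinMap_single, form_single, form_single] at h
  simp only [Pi.add_apply, Pi.sub_apply, Pi.smul_apply, Finset.sum_apply, smul_eq_mul,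
    Function.comp_apply, Equiv.apply_symm_apply] at h
  refine (add_mem_cancel_left ?_).1 h
  exact S.sub_mem (S.add_mem (S.mul_mem (hε _) (hsingle _ _)) (S.mul_mem (hε _) (hsingle _ _)))
    (S.mul_mem (S.mul_mem (hε _) (hε _)) (hd _))

-- Only the `u`-component of `kerVec` contributes to the coordinate `none`, so that coordinate of
-- `Q(e_v, e_v')` can be divided by `u none`. Knowing this sum removes the `u`-component from the
-- other coordinates: those in `W` then give `q`, and those in `V` give the sums of `q * p`.
include hint hinv hc hd in
theorem sum_mul_aug_mem (hu : u none ≠ 0) (v v' : V) :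
    ∑ w, q s(v, v') w * (ε (.inr w) - ∑ v, p v w * ε (.inl v)) ∈ S := by
  have h := S.mul_mem (sum_mul_kerVec_mem e ε p q S hint hc hd hu v v' none)
    (hinv _ (hd none))
  simp only [kerVec, mul_neg, Finset.sum_neg_distrib, ← mul_assoc, ← Finset.sum_mul, neg_mul,
    mul_inv_cancel_right₀ hu] at h
  exact neg_mem_iff.1 h

include hint hinv hc hd in
theorem quadric_mem (hu : u none ≠ 0) (s : Sym2 V) (w : W) : q s w ∈ S := by
  induction s with
  | _ v v' =>
  have h := sum_mul_kerVec_mem e ε p q S hint hc hd hu v v' (some (.inr w))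
  have hα := sum_mul_aug_mem e ε p q S hint hinv hc hd hu v v'
  have h2 := S.add_mem h (S.mul_mem hα (hd (some (.inr w))))
  rw [Finset.sum_mul, ← Finset.sum_add_distrib] at h2
  convert! h2 using 1
  trans ∑ x, if x = w then q s(v, v') x else 0
  · simp
  · refine Finset.sum_congr rfl fun x _ => ?_
    simp only [kerVec]
    split_ifs <;> ring

include hint hinv hc hd in
theorem sum_quadric_mul_mem (hu : u none ≠ 0) (s : Sym2 V) (v₀ : V) :
    ∑ w, q s w * p v₀ w ∈ S := by
  induction s with
  | _ v v' =>
  have h := sum_mul_kerVec_mem e ε p q S hint hc hd hu v v' (some (.inl v₀))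
  have hα := sum_mul_aug_mem e ε p q S hint hinv hc hd hu v v'
  have h2 := S.add_mem h (S.mul_mem hα (hd (some (.inl v₀))))
  rw [Finset.sum_mul, ← Finset.sum_add_distrib] at h2
  refine neg_mem_iff.1 ?_
  rw [← Finset.sum_neg_distrib]
  convert! h2 using 2
  simp only [kerVec]
  ring

-- For fixed `v`, the sums of `q * p` are linear equations for `p v` with coefficients in `S`. The
-- rows chosen by `σ` form an invertible square system, solved by Cramer's rule.
include hint hinv hc hd in
theorem projVec_mem (hu : u none ≠ 0) (σ : W → Sym2 V)
    (hσ : (Matrix.of fun w w' => q (σ w) w').det ≠ 0) (v : V) (w : W) : p v w ∈ S := by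
  have hq := quadric_mem e ε p q S hint hinv hc hd hu
  let M : Matrix W W S := Matrix.of fun w w' => ⟨q (σ w) w', hq _ _⟩
  let y : W → S := fun w =>
    ⟨∑ w', q (σ w) w' * p v w', sum_quadric_mul_mem e ε p q S hint hinv hc hd hu (σ w) v⟩
  let N : Matrix W W K := Matrix.of fun w w' => q (σ w) w'
  have hMN : S.val.toRingHom.mapMatrix M = N := rfl
  have hy : (fun w => (y w : K)) = N.mulVec (p v) := rfl
  have h1 : N.adjugate.mulVec (fun w => (y w : K)) = N.det • p v := by
    rw [hy, Matrix.mulVec_mulVec, Matrix.adjugate_mul, Matrix.smul_mulVec, Matrix.one_mulVec]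
  have h2 : N.det * p v w ∈ S := by
    have h3 := congrFun h1 w
    rw [Pi.smul_apply, smul_eq_mul] at h3
    rw [← h3, ← hMN, ← RingHom.map_adjugate]
    exact S.sum_mem fun w' _ => S.mul_mem (SetLike.coe_mem _) (SetLike.coe_mem _)
  have h4 : N.det ∈ S := by
    rw [← hMN, ← RingHom.map_det]
    exact SetLike.coe_mem _
  have h5 := S.mul_mem (hinv _ h4) h2
  rwa [inv_mul_cancel_left₀ hσ] at h5

end Recovery

end Family

/-! ### The fibre over a field and its generic family -/

open scoped TensorProduct

/-- The fibre over a field of a scheme of finite type over the spectrum of a ring with at most one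
homomorphism to each field. -/
theorem exists_fibre_ring {R C k : Type u} [CommRing R] [CommRing C] [Field k] (φ : R →+* C)
    (ψ : R →+* k) (hφ : φ.FiniteType)
    (huniq : ∀ {K : Type u} [Field K] (f g : R →+* K), f = g) :
    ∃ (A : Type u) (_ : CommRing A) (_ : Algebra k A) (j : C →+* A), Algebra.FiniteType k A ∧
      topologicalKrullDim (pullback (Spec.map (CommRingCat.ofHom φ))
        (Spec.map (CommRingCat.ofHom ψ)) : Scheme.{u}) = ringKrullDim A ∧
      ∀ (K : Type u) [Field K] [Algebra k K] (g : C →+* K), ∃ f : A →ₐ[k] K,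
        ∀ x, f (j x) = g x := by
  algebraize [φ, ψ]
  refine ⟨k ⊗[R] C, inferInstance, inferInstance,
    (Algebra.TensorProduct.includeRight : C →ₐ[R] k ⊗[R] C).toRingHom, inferInstance, ?_, ?_⟩
  · rw [← PrimeSpectrum.topologicalKrullDim_eq_ringKrullDim]
    let i := pullbackSymmetry (Spec.map (CommRingCat.ofHom φ)) (Spec.map (CommRingCat.ofHom ψ)) ≪≫
      pullbackSpecIso R k C
    exact IsHomeomorph.topologicalKrullDim_eq _ (Scheme.homeoOfIso i).isHomeomorph
  · intro K _ _ g
    let : Algebra R K := ((algebraMap k K).comp ψ).toAlgebra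
    have : IsScalarTower R k K := IsScalarTower.of_algebraMap_eq' rfl
    -- `K` is an `R`-algebra through `k`; uniqueness of maps from `R` to a field makes `g` linear
    -- for this structure.
    let g' : C →ₐ[R] K :=
      { g with commutes' := DFunLike.congr_fun (huniq (g.comp φ) _) }
    refine ⟨Algebra.TensorProduct.lift (Algebra.ofId k K) g' fun _ _ => .all _ _, fun x => ?_⟩
    exact (Algebra.TensorProduct.lift_tmul _ _ _ 1 x).trans (by rw [map_one, one_mul]; rfl)

/-- The index set of the parameters `u`, `ε`, `p`, `q` of the family of local algebras. -/
abbrev Param (V W : Type) : Type :=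
  Option (V ⊕ W) ⊕ (V ⊕ W) ⊕ (V × W) ⊕ (Sym2 V × W)

theorem card_param (d r : ℕ) :
    Nat.card (Param (Fin d) (Fin r)) =
      (d + r + 1) + ((d + r) + (d * r + (d + 1).choose 2 * r)) := by
  simp [Sym2.card]

theorem det_variables_ne_zero {W ι R : Type*} [Fintype W] [DecidableEq W] [CommRing R]
    [Nontrivial R] (τ : W × W → ι) (hτ : Function.Injective τ) :
    (Matrix.of fun w w' => (MvPolynomial.X (τ (w, w')) : MvPolynomial ι R)).det ≠ 0 := by
  have h : (Matrix.of fun w w' => (MvPolynomial.X (τ (w, w')) : MvPolynomial ι R)) =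
      (MvPolynomial.rename (R := R) τ).toRingHom.mapMatrix (Matrix.mvPolynomialX W W R) := by
    ext1 w w'
    simp
  rw [h, ← RingHom.map_det]
  intro h0
  exact Matrix.det_mvPolynomialX_ne_zero W R
    (MvPolynomial.rename_injective τ hτ (h0.trans (map_zero _).symm))

theorem isAlgebraic_fractionRing_mvPolynomial {k ι : Type*} [Field k]
    (B : Subalgebra k (FractionRing (MvPolynomial ι k)))
    (h : ∀ i, IsAlgebraic B
      (algebraMap (MvPolynomial ι k) (FractionRing (MvPolynomial ι k)) (MvPolynomial.X i))) :
    Algebra.IsAlgebraic B (FractionRing (MvPolynomial ι k)) := by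
  have h1 : ∀ P : MvPolynomial ι k,
      IsAlgebraic B (algebraMap _ (FractionRing (MvPolynomial ι k)) P) := fun P => by
    induction P using MvPolynomial.induction_on with
    | C a => exact isAlgebraic_algebraMap (algebraMap k B a)
    | add P Q hP hQ => rw [map_add]; exact hP.add hQ
    | mul_X P i hP => rw [map_mul]; exact hP.mul (h i)
  refine ⟨fun x => ?_⟩
  obtain ⟨P, Q, -, rfl⟩ := IsFractionRing.div_surjective (A := MvPolynomial ι k) x
  rw [div_eq_mul_inv]
  exact (h1 P).mul (h1 Q).inv

theorem mem_algebraicClosure_of_isIntegral {B K : Type*} [CommRing B] [IsDomain B] [Field K]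
    [Algebra B K] (x : K) (hx : IsIntegral (Subalgebra.algebraicClosure B K) x) :
    x ∈ Subalgebra.algebraicClosure B K :=
  have := hx.isAlgebraic
  this.restrictScalars B

theorem ringHom_intU_eq {R : Type*} [Semiring R] (f g : IntU.{u} →+* R) : f = g := by
  have h : f.comp ULift.ringEquiv.symm.toRingHom = g.comp ULift.ringEquiv.symm.toRingHom :=
    RingHom.ext_int _ _
  ext x
  exact DFunLike.congr_fun h x.down

/-- A lower bound for the dimension of the moduli space from the family of local algebras
`k ⊕ V ⊕ W` with `dim V = d`, `dim W = r` and `V * V ⊆ W`. -/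
theorem card_param_le_ringKrullDim (k : Type u) [Field k] (d r n : ℕ)
    (hn : n = d + r + 1) (hr : r ≤ (d + 1).choose 2) (A : Type u) [CommRing A] [Algebra k A]
    [Algebra.FiniteType k A] (j : CoordRing.{u} n →+* A)
    (hj : ∀ (K : Type u) [Field K] [Algebra k K] (g : CoordRing.{u} n →+* K),
      ∃ f : A →ₐ[k] K, ∀ x, f (j x) = g x) :
    (Nat.card (Param (Fin d) (Fin r)) : WithBot ℕ∞) ≤ ringKrullDim A := by
  let V := Fin d
  let W := Fin r
  let ι := Param V W
  let K := FractionRing (MvPolynomial ι k)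
  have e : Fin n ≃ Option (V ⊕ W) := Fintype.equivOfCardEq (by simp [V, W, hn])
  have hinj : Function.Injective (algebraMap (MvPolynomial ι k) K) :=
    IsFractionRing.injective _ _
  let t : ι → K := fun i => algebraMap (MvPolynomial ι k) K (MvPolynomial.X i)
  let u : Option (V ⊕ W) → K := fun i => t (.inl i)
  let ε : V ⊕ W → K := fun i => t (.inr (.inl i))
  let p : V → W → K := fun v w => t (.inr (.inr (.inl (v, w))))
  let q : Sym2 V → W → K := fun s w => t (.inr (.inr (.inr (s, w))))
  have hu : u none ≠ 0 := by
    intro h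
    exact MvPolynomial.X_ne_zero _ (hinj (h.trans (map_zero _).symm))
  have ht : AlgebraicIndependent k t :=
    (MvPolynomial.algebraicIndependent_X ι k).map' (f := IsScalarTower.toAlgHom k _ K) hinj
  let g : CoordRing.{u} n →+* K := (homEquiv n K).symm
    ⟨(_, _), isStructureConstants_familyMul e ε p q hu⟩
  have hg := (homEquiv.{u} n K).apply_symm_apply
    ⟨(_, _), isStructureConstants_familyMul e ε p q hu⟩
  have hgc : ∀ i j l, g (Ideal.Quotient.mk _ (genC n i j l)) =
      familyMul e u ε p q (Pi.single i 1) (Pi.single j 1) l := fun i j l =>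
    congrFun (congrFun (congrFun (congrArg (fun z => z.1.1) hg) i) j) l
  have hgd : ∀ i, g (Ideal.Quotient.mk _ (genD n i)) = u (e i) := fun i =>
    congrFun (congrArg (fun z => z.1.2) hg) i
  obtain ⟨f, hfg⟩ := hj K g
  have hf : ∀ x, g x ∈ f.range := fun x => ⟨j x, hfg x⟩
  -- Elements algebraic over the image are closed under inverses and integral extension, as the
  -- recovery lemmas require.
  let S : Subalgebra f.range K := Subalgebra.algebraicClosure f.range K
  have hfS : ∀ x, g x ∈ S := fun x => isAlgebraic_algebraMap (⟨g x, hf x⟩ : f.range)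
  have hint : ∀ x, IsIntegral S x → x ∈ S := mem_algebraicClosure_of_isIntegral
  have hinv : ∀ x ∈ S, x⁻¹ ∈ S := fun x hx => IsAlgebraic.inv hx
  have hc : ∀ i j l, familyMul e u ε p q (Pi.single i 1) (Pi.single j 1) l ∈ S :=
    fun i j l => hgc i j l ▸ hfS _
  have hd : ∀ i, u i ∈ S := fun i => by
    have := hfS (Ideal.Quotient.mk _ (genD n (e.symm i)))
    rwa [hgd, Equiv.apply_symm_apply] at this
  -- Here `r ≤ (d + 1).choose 2` is needed: `r` distinct products in `V * V` give a square matrix of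
  -- distinct variables, with nonzero determinant.
  obtain ⟨σ⟩ : Nonempty (W ↪ Sym2 V) :=
    Function.Embedding.nonempty_of_card_le (by simpa [V, W, Sym2.card] using hr)
  have hσ : (Matrix.of fun w w' => q (σ w) w').det ≠ 0 := by
    have h := det_variables_ne_zero (R := k) (ι := ι)
      (fun w : W × W => .inr (.inr (.inr (σ w.1, w.2)))) fun a b hab => by
        have h := Prod.mk.inj (Sum.inr_injective (Sum.inr_injective (Sum.inr_injective hab)))
        exact Prod.ext (σ.injective h.1) h.2
    intro h0
    refine h (hinj ?_)
    rw [RingHom.map_det, map_zero, ← h0]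
    rfl
  have htS : ∀ i, t i ∈ S
    | .inl i => hd i
    | .inr (.inl i) => augVec_mem e ε p q S hint hc hu (some i)
    | .inr (.inr (.inl (v, w))) => projVec_mem e ε p q S hint hinv hc hd hu σ hσ v w
    | .inr (.inr (.inr (s, w))) => quadric_mem e ε p q S hint hinv hc hd hu s w
  have : Algebra.IsAlgebraic f.range K := isAlgebraic_fractionRing_mvPolynomial f.range htS
  exact natCard_le_ringKrullDim_of_isAlgebraic_range f ht

theorem finiteType_coordRing (n : ℕ) :
    RingHom.FiniteType (A := IntU.{u}) (B := CoordRing.{u} n) (algebraMap _ _) := by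
  have : Finite (Var n) :=
    Finite.of_injective (β := (Fin n × Fin n × Fin n) ⊕ Fin n)
      (fun x => match x with
        | .c i j l => .inl (i, j, l)
        | .d i => .inr i)
      (by rintro (_ | _) (_ | _) h <;> simp_all)
  rw [RingHom.finiteType_algebraMap]
  exact Algebra.FiniteType.of_surjective (Ideal.Quotient.mkₐ _ (relations.{u} n))
    (Ideal.Quotient.mkₐ_surjective _ _)

/-- The dimension of the fibre of the moduli space is finite, and is bounded below by the number
of parameters of each of the families of local algebras. -/
theorem exists_topologicalKrullDim_eq (k : Type u) [Field k] (n : ℕ) (hn : 1 ≤ n) :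
    ∃ D : ℕ, topologicalKrullDim (baseChange (moduliSpace.{u} n) k) = D ∧
      ∀ d r : ℕ, n = d + r + 1 → r ≤ (d + 1).choose 2 →
        (d + r + 1) + ((d + r) + (d * r + (d + 1).choose 2 * r)) ≤ D := by
  obtain ⟨A, _, _, j, _, hdim, hj⟩ := exists_fibre_ring (R := IntU.{u})
    (C := CoordRing.{u} n) (k := k) (algebraMap _ _)
    ((Int.castRingHom k).comp ULift.ringEquiv.toRingHom) (finiteType_coordRing n)
    (ringHom_intU_eq)
  have hb := fun d r hd hr => card_param_le_ringKrullDim k d r n hd hr A j hj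
  have hA : Nontrivial A := by
    by_contra h
    rw [not_nontrivial_iff_subsingleton] at h
    -- The family with `W = 0` already bounds the dimension below by a natural number, which
    -- excludes the zero ring.
    have := hb (n - 1) 0 (by omega) (Nat.zero_le _)
    rw [ringKrullDim_eq_bot_of_subsingleton] at this
    simp at this
  obtain ⟨D, hD⟩ := exists_natCast_eq_ringKrullDim k A
  refine ⟨D, ?_, fun d r hd hr => ?_⟩
  · rw [← hD, ← hdim]
    exact IsHomeomorph.topologicalKrullDim_eq _ (Scheme.homeoOfIso
      (pullback.congrHom (specULiftZIsTerminal.hom_ext _ _)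
        (specULiftZIsTerminal.hom_ext _ _))).isHomeomorph
  · have := hb d r hd hr
    rw [hD, card_param] at this
    exact_mod_cast this

end BasedAlgebras

/-! ### Choice of `d` and `r` -/

theorem mainTheorem8 (n : ℕ) (hn : 1 ≤ n) (k : Type u) [Field k] :
    ∃ D : ℕ,
      topologicalKrullDim (BasedAlgebras.baseChange (BasedAlgebras.moduliSpace.{u} n) k) = D ∧
      (n ≡ 0 [MOD 3] →
        2 / 27 * (n : ℝ) ^ 3 + 1 / 9 * (n : ℝ) ^ 2 + 5 / 3 * (n : ℝ) - 1 ≤ (D : ℝ)) ∧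
      (n ≡ 1 [MOD 3] →
        2 / 27 * (n : ℝ) ^ 3 + 1 / 9 * (n : ℝ) ^ 2 + 14 / 9 * (n : ℝ) - 20 / 27 ≤ (D : ℝ)) ∧
      (n ≡ 2 [MOD 3] →
        2 / 27 * (n : ℝ) ^ 3 + 1 / 9 * (n : ℝ) ^ 2 + 5 / 3 * (n : ℝ) - 37 / 27 ≤ (D : ℝ)) ∧
      (11 ≤ n → n ^ 2 < D) := by
  obtain ⟨D, hD, hb⟩ := BasedAlgebras.exists_topologicalKrullDim_eq k n hn
  have hchoose : ∀ d : ℕ, (((d + 1).choose 2 : ℕ) : ℝ) = (d + 1) * d / 2 := fun d => by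
    rw [Nat.cast_choose_two]
    push_cast
    ring
  have hbound : ∀ d r : ℕ, n = d + r + 1 → r ≤ (d + 1).choose 2 →
      (d + r + 1 : ℝ) + ((d + r) + (d * r + (d + 1) * d / 2 * r)) ≤ D := fun d r hd hr => by
    have h : (((d + r + 1) + ((d + r) + (d * r + (d + 1).choose 2 * r)) : ℕ) : ℝ) ≤ D :=
      Nat.cast_le.2 (hb d r hd hr)
    push_cast [hchoose] at h
    exact h
  have h0 : n ≡ 0 [MOD 3] →
      2 / 27 * (n : ℝ) ^ 3 + 1 / 9 * (n : ℝ) ^ 2 + 5 / 3 * (n : ℝ) - 1 ≤ (D : ℝ) := fun h => by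
    obtain ⟨m, rfl⟩ : ∃ m, n = 3 * m + 3 := ⟨n / 3 - 1, by unfold Nat.ModEq at h; omega⟩
    -- In each residue class, `d` near `2 * n / 3` makes the parameter count equal to the stated
    -- polynomial.
    have := hbound (2 * m + 1) (m + 1) (by ring) (by
      rw [Nat.choose_two_right, Nat.le_div_iff_mul_le two_pos, Nat.add_sub_cancel]
      nlinarith)
    push_cast at this ⊢
    linarith
  have h1 : n ≡ 1 [MOD 3] →
      2 / 27 * (n : ℝ) ^ 3 + 1 / 9 * (n : ℝ) ^ 2 + 14 / 9 * (n : ℝ) - 20 / 27 ≤ (D : ℝ) :=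
    fun h => by
      obtain ⟨m, rfl⟩ : ∃ m, n = 3 * m + 1 := ⟨n / 3, by unfold Nat.ModEq at h; omega⟩
      have := hbound (2 * m) m (by ring) (by
        rw [Nat.choose_two_right, Nat.le_div_iff_mul_le two_pos, Nat.add_sub_cancel]
        nlinarith)
      push_cast at this ⊢
      linarith
  have h2 : n ≡ 2 [MOD 3] →
      2 / 27 * (n : ℝ) ^ 3 + 1 / 9 * (n : ℝ) ^ 2 + 5 / 3 * (n : ℝ) - 37 / 27 ≤ (D : ℝ) :=
    fun h => by
      obtain ⟨m, rfl⟩ : ∃ m, n = 3 * m + 2 := ⟨n / 3, by unfold Nat.ModEq at h; omega⟩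
      -- For `n = 2` the general choice would be `d = 0`, `r = 1`, which violates `r ≤ (d +
      -- 1).choose 2`; `d = 1`, `r = 0` gives the same count.
      rcases Nat.eq_zero_or_pos m with rfl | hm
      · have := hbound 1 0 rfl (Nat.zero_le _)
        norm_num at this ⊢
        linarith
      · have := hbound (2 * m) (m + 1) (by ring) (by
          rw [Nat.choose_two_right, Nat.le_div_iff_mul_le two_pos, Nat.add_sub_cancel]
          nlinarith)
        push_cast at this ⊢
        linarith
  refine ⟨D, hD, h0, h1, h2, fun hn11 => ?_⟩
  have hx : (11 : ℝ) ≤ n := by exact_mod_cast hn11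
  have hx2 := mul_nonneg (sq_nonneg (n : ℝ)) (sub_nonneg.2 hx)
  suffices h : (n : ℝ) ^ 2 < D by exact_mod_cast h
  have h3 : n % 3 = 0 ∨ n % 3 = 1 ∨ n % 3 = 2 := by omega
  rcases h3 with h | h | h
  · have := h0 h
    nlinarith
  · have := h1 h
    nlinarith
  · have := h2 h
    nlinarith
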